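/- Let $N\ge 3$, let $\Omega\subset\mathbb R^N$ be a bounded open set, and let $1<p<N$, $q>0$, $\mu>0$ and $k>N/p$ be real numbers. Let $W_0^{1,p}(\Omega)$ be the closure of $C_c^\infty(\Omega)$ in $W^{1,p}(\Omega)$, with the norm $\|v\|=\left(\int_\Omega|\nabla v|^p\right)^{1/p}$, and write $\|\cdot\|_k$ for the norm of $L^k(\Omega)$. For $s>-1/\mu$ put $$g(s)=\frac{(p-1)^{q-p+1}}{\mu^q}(1+\mu s)^{p-1}\,|\ln(1+\mu s)|^{q-1}\ln(1+\mu s),\qquad f(s)=\frac{(1+\mu s)^{p-1}}{(p-1)^{p-1}},$$ and put $g(s)=f(s)=0$ for $s\le -1/\mu$ (the continuous extension by zero). Let $G(s)=\int_0^s g(t)\,dt$ and $F(s)=\int_0^s f(t)\,dt$. For $c,h\in L^k(\Omega)$ let $$I(v)=\frac1p\int_\Omega|\nabla v|^p-\int_\Omega c(x)\,G(v)\,dx-\int_\Omega h(x)\,F(v)\,dx,\qquad v\in W_0^{1,p}(\Omega).$$ Then there is $\delta>0$, depending only on $N,\Omega,p,q,\mu,k$, such that for all $c,h\in L^k(\Omega)$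 with $c\ge 0$ a.e. in $\Omega$, $c$ not a.e. equal to $0$, $\|c\|_k<\delta$ and $\|h\|_k<\delta$, the functional $I$ is well defined on $W_0^{1,p}(\Omega)$ (that is, $c\,G(v)$ and $h\,F(v)$ are integrable on $\Omega$ for every $v\in W_0^{1,p}(\Omega)$), and the following hold. 1. There are $\rho>0$ and $\beta>0$ such that $I(v)\ge\beta$ for all $v\in W_0^{1,p}(\Omega)$ with $\|v\|=\rho$; and, for the same $\rho$, there is $v_0\in W_0^{1,p}(\Omega)$ with $\|v_0\|>\rho$ and $I(v_0)\le 0$. 2. For every $v\in W_0^{1,p}(\Omega)$ with $v\ge 0$ a.e. in $\Omega$ and $cv$ not a.e. equal to $0$, one has $I(tv)\to-\infty$ as $t\to+\infty$. -/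

import Mathlib

open MeasureTheory Filter Topology
open scoped ContDiff ENNReal

namespace PGradient

noncomputable section

/-- Makes `L^p` a normed space for a real exponent `p > 1`. -/
instance factOneLeOfReal (p : ℝ) [hp : Fact (1 < p)] : Fact (1 ≤ ENNReal.ofReal p) :=
  ⟨by simpa using hp.out.le⟩

/-- Test functions: `C_c^∞(Ω)`, extended by zero outside `Ω`. -/
def IsTestFunction {N : ℕ} (Ω : Set (EuclideanSpace ℝ (Fin N)))
    (φ : EuclideanSpace ℝ (Fin N) → ℝ) : Prop :=
  ContDiff ℝ ∞ φ ∧ HasCompactSupport φ ∧ tsupport φ ⊆ Ω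

/-- The pairs `(φ, ∇φ)` with `φ ∈ C_c^∞(Ω)`, as elements of `L^p(Ω) × L^p(Ω; ℝ^N)`. -/
def testPairs {N : ℕ} (Ω : Set (EuclideanSpace ℝ (Fin N))) (p : ℝ) :
    Set (Lp ℝ (ENNReal.ofReal p) (volume.restrict Ω) ×
      Lp (EuclideanSpace ℝ (Fin N)) (ENNReal.ofReal p) (volume.restrict Ω)) :=
  {z | ∃ φ : EuclideanSpace ℝ (Fin N) → ℝ, IsTestFunction Ω φ ∧
    z.1 =ᵐ[volume.restrict Ω] φ ∧ z.2 =ᵐ[volume.restrict Ω] gradient φ}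

/-- `W_0^{1,p}(Ω)`: the closure of `C_c^∞(Ω)` in the Sobolev norm. A Sobolev function `v` is
represented by the pair `(v, ∇v)` of `L^p` classes, so that the Sobolev norm is (equivalent to) the
norm of `L^p × L^p`; the second component of an element of the closure is the weak gradient of the
first, because weak gradients are stable under `L^p` limits. -/
def W01p {N : ℕ} (Ω : Set (EuclideanSpace ℝ (Fin N))) (p : ℝ) [Fact (1 < p)] :
    Submodule ℝ (Lp ℝ (ENNReal.ofReal p) (volume.restrict Ω) ×
      Lp (EuclideanSpace ℝ (Fin N)) (ENNReal.ofReal p) (volume.restrict Ω)) :=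
  (Submodule.span ℝ (testPairs Ω p)).topologicalClosure

variable {N : ℕ} {Ω : Set (EuclideanSpace ℝ (Fin N))} {p : ℝ} [Fact (1 < p)]

/-- The function underlying an element of `W_0^{1,p}(Ω)`. -/
def fn (v : W01p Ω p) : EuclideanSpace ℝ (Fin N) → ℝ := v.1.1

/-- The weak gradient of an element of `W_0^{1,p}(Ω)`. -/
def grad (v : W01p Ω p) : EuclideanSpace ℝ (Fin N) → EuclideanSpace ℝ (Fin N) := v.1.2

/-- The Poincaré norm `(∫_Ω |∇v|^p)^{1/p}`. -/
def poincareNorm (v : W01p Ω p) : ℝ := (∫ x in Ω, ‖grad v x‖ ^ p) ^ (1 / p)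

/-- The nonlinearity `g`, extended from `(-1/μ, ∞)` to `ℝ` by zero (its limit at `-1/μ`). -/
def g (p q μ s : ℝ) : ℝ :=
  if -1 / μ < s then
    (p - 1) ^ (q - p + 1) / μ ^ q * (1 + μ * s) ^ (p - 1)
      * |Real.log (1 + μ * s)| ^ (q - 1) * Real.log (1 + μ * s)
  else 0

/-- The nonlinearity `f`, extended from `(-1/μ, ∞)` to `ℝ` by zero (its limit at `-1/μ`). -/
def f (p μ s : ℝ) : ℝ :=
  if -1 / μ < s then (1 + μ * s) ^ (p - 1) / (p - 1) ^ (p - 1) else 0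

/-- The primitive of `g` vanishing at `0`. -/
def G (p q μ s : ℝ) : ℝ := ∫ t in (0 : ℝ)..s, g p q μ t

/-- The primitive of `f` vanishing at `0`. -/
def F (p μ s : ℝ) : ℝ := ∫ t in (0 : ℝ)..s, f p μ t

/-- The functional `I(v) = (1/p) ∫_Ω |∇v|^p - ∫_Ω c G(v) - ∫_Ω h F(v)` on `W_0^{1,p}(Ω)`. -/
def energy (q μ : ℝ) (c h : EuclideanSpace ℝ (Fin N) → ℝ) (v : W01p Ω p) : ℝ :=
  1 / p * (∫ x in Ω, ‖grad v x‖ ^ p) - (∫ x in Ω, c x * G p q μ (fn v x))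
    - ∫ x in Ω, h x * F p μ (fn v x)

end

end PGradient

namespace PGradient

/-! ### Growth of the nonlinearities -/

/-! The primitive `G` exceeds the `p`-th power only by a power of a logarithm. It is therefore
`O((1+|s|)^r)` for every `r` slightly above `p`, while `G(tη)/t^p → ∞` for `η > 0`. The primitive
`F` is `O((1+|s|)^p)`.

Upper side: `k > N/p` leaves room for an `r > p` with `k'r` at most the Sobolev exponent. Hölder and
Sobolev then bound both lower order terms by `‖c‖_k` or `‖h‖_k` times a constant multiple of
`(A(1+‖v‖))^r`, with `A` independent of `c`, `h`, `v` (`exists_integral_weight_mul_rpow_le`). On the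
unit sphere, a small `δ` makes them together at most half of `1/p`, so `ρ = 1` and `β = 1/(2p)`
work.

Lower side: if `v ≥ 0` and `cv ≢ 0`, then `c ≥ η` and `v ≥ η` on a set of positive measure. There
the `G` term beats the gradient and `F` terms, both `O(t^p)` along the ray
(`tendsto_energy_smul_atBot`). The far point `v₀` lies on such a ray, directed by a bump function
placed where `c` is nonzero. -/

theorem rpow_mul_abs_log_rpow_le {a ε q u : ℝ} (hε : 0 < ε) (hεa : ε ≤ a) (hq : 0 < q)
    (hu : 0 < u) :
    u ^ a * |Real.log u| ^ q ≤ (q / ε) ^ q * (1 + u) ^ (a + ε) := by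
  have key : ∀ w : ℝ, 1 ≤ w → |Real.log w| ^ q ≤ (q / ε) ^ q * w ^ ε := by
    intro w hw
    have hw0 : 0 < w := by linarith
    rw [abs_of_nonneg (Real.log_nonneg hw)]
    calc Real.log w ^ q ≤ (w ^ (ε / q) / (ε / q)) ^ q := by
          have := Real.log_nonneg hw
          gcongr
          exact Real.log_le_rpow_div hw0.le (by positivity)
      _ = (q / ε * w ^ (ε / q)) ^ q := by
          congr 1
          field_simp
      _ = (q / ε) ^ q * w ^ ε := by
          rw [Real.mul_rpow (by positivity) (by positivity), ← Real.rpow_mul hw0.le]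
          congr 2
          field_simp
  rcases le_total 1 u with h1 | h1
  · calc u ^ a * |Real.log u| ^ q ≤ u ^ a * ((q / ε) ^ q * u ^ ε) := by
          gcongr
          exact key u h1
      _ = (q / ε) ^ q * u ^ (a + ε) := by rw [Real.rpow_add hu]; ring
      _ ≤ _ := by
          have : 0 ≤ a + ε := by linarith
          gcongr
          linarith
  -- Near zero the logarithm costs `u^(-ε)`, which `u^a` absorbs because `ε ≤ a`.
  · have h2 := key u⁻¹ ((one_le_inv₀ hu).2 h1)
    rw [Real.log_inv, abs_neg, Real.inv_rpow hu.le, ← Real.rpow_neg hu.le] at h2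
    calc u ^ a * |Real.log u| ^ q ≤ u ^ a * ((q / ε) ^ q * u ^ (-ε)) := by gcongr
      _ = (q / ε) ^ q * u ^ (a + -ε) := by rw [Real.rpow_add hu]; ring
      _ ≤ (q / ε) ^ q * 1 := by
          gcongr
          exact Real.rpow_le_one hu.le h1 (by linarith)
      _ ≤ _ := by
          gcongr
          exact Real.one_le_rpow (by linarith) (by linarith)

theorem one_add_mul_pos {μ s : ℝ} (hμ : 0 < μ) (hs : -1 / μ < s) : 0 < 1 + μ * s := by
  rw [div_lt_iff₀ hμ] at hs
  linarith

theorem two_add_mul_le {μ s : ℝ} (hμ : 0 < μ) : 2 + μ * s ≤ (2 + μ) * (1 + |s|) := by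
  nlinarith [le_abs_self s, abs_nonneg s]

theorem exists_abs_g_le {p q μ ε : ℝ} (hp : 1 < p) (hq : 0 < q) (hμ : 0 < μ) (hε : 0 < ε)
    (hεp : ε ≤ p - 1) :
    ∃ C, 0 ≤ C ∧ ∀ s, |g p q μ s| ≤ C * (1 + |s|) ^ (p - 1 + ε) := by
  have hp' : 0 < p - 1 := by linarith
  refine ⟨(p - 1) ^ (q - p + 1) / μ ^ q * ((q / ε) ^ q * (2 + μ) ^ (p - 1 + ε)), by positivity,
    fun s ↦ ?_⟩
  unfold g
  split_ifs with hs
  · have hu := one_add_mul_pos hμ hs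
    -- For `q < 1` the exponent `q - 1` is negative, so the zero of the logarithm is treated
    -- separately.
    have h1 : |Real.log (1 + μ * s)| ^ (q - 1) * |Real.log (1 + μ * s)|
        ≤ |Real.log (1 + μ * s)| ^ q := by
      rcases (abs_nonneg (Real.log (1 + μ * s))).eq_or_lt with h | h
      · rw [← h, mul_zero]; positivity
      · rw [← Real.rpow_add_one h.ne']; simp
    rw [abs_mul, abs_of_nonneg (a := _ * _ ^ (q - 1)) (by positivity), mul_assoc]
    calc _ ≤ (p - 1) ^ (q - p + 1) / μ ^ q * (1 + μ * s) ^ (p - 1)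
            * |Real.log (1 + μ * s)| ^ q := by gcongr
      _ = (p - 1) ^ (q - p + 1) / μ ^ q
            * ((1 + μ * s) ^ (p - 1) * |Real.log (1 + μ * s)| ^ q) := by ring
      _ ≤ (p - 1) ^ (q - p + 1) / μ ^ q
            * ((q / ε) ^ q * (1 + (1 + μ * s)) ^ (p - 1 + ε)) := by
          exact mul_le_mul_of_nonneg_left (rpow_mul_abs_log_rpow_le hε hεp hq hu) (by positivity)
      _ ≤ (p - 1) ^ (q - p + 1) / μ ^ q
            * ((q / ε) ^ q * ((2 + μ) * (1 + |s|)) ^ (p - 1 + ε)) := by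
          gcongr
          linarith [two_add_mul_le (s := s) hμ]
      _ = _ := by
          rw [Real.mul_rpow (by positivity) (by positivity)]
          ring
  · rw [abs_zero]; positivity

theorem exists_abs_f_le {p μ : ℝ} (hp : 1 < p) (hμ : 0 < μ) :
    ∃ C, 0 ≤ C ∧ ∀ s, |f p μ s| ≤ C * (1 + |s|) ^ (p - 1) := by
  have hp' : 0 < p - 1 := by linarith
  refine ⟨(2 + μ) ^ (p - 1) / (p - 1) ^ (p - 1), by positivity, fun s ↦ ?_⟩
  unfold f
  split_ifs with hs
  · have hu := one_add_mul_pos hμ hs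
    rw [abs_of_nonneg (by positivity), div_mul_eq_mul_div, ← Real.mul_rpow (by positivity)
      (by positivity)]
    gcongr
    linarith [two_add_mul_le (s := s) hμ]
  · rw [abs_zero]; positivity

theorem measurable_g (p q μ : ℝ) : Measurable (g p q μ) := by
  unfold g
  refine Measurable.ite measurableSet_Ioi ?_ measurable_const
  have : Measurable fun s : ℝ ↦ |Real.log (1 + μ * s)| := by
    exact (Real.measurable_log.comp (by fun_prop : Measurable fun s : ℝ ↦ 1 + μ * s)).norm
  fun_prop

theorem measurable_f (p μ : ℝ) : Measurable (f p μ) := by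
  unfold f
  exact Measurable.ite measurableSet_Ioi (by fun_prop) measurable_const

theorem abs_le_of_mem_uIcc {s t : ℝ} (ht : t ∈ Set.uIcc 0 s) : |t| ≤ |s| := by
  simpa using Set.abs_sub_left_of_mem_uIcc ht

theorem intervalIntegrable_of_growth {φ : ℝ → ℝ} {C a : ℝ} (hφ : Measurable φ) (ha : 0 ≤ a)
    (h : ∀ s, |φ s| ≤ C * (1 + |s|) ^ a) (x y : ℝ) : IntervalIntegrable φ volume x y := by
  have hc : Continuous fun s : ℝ ↦ C * (1 + |s|) ^ a :=
    continuous_const.mul ((by fun_prop : Continuous fun s : ℝ ↦ 1 + |s|).rpow_const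
      fun _ ↦ Or.inr ha)
  refine (hc.intervalIntegrable x y).mono_fun hφ.aestronglyMeasurable
    (Eventually.of_forall fun s ↦ ?_)
  exact (h s).trans (le_abs_self _)

theorem abs_primitive_le_of_growth {φ : ℝ → ℝ} {C a : ℝ} (hC : 0 ≤ C) (ha : 0 ≤ a)
    (h : ∀ s, |φ s| ≤ C * (1 + |s|) ^ a) (s : ℝ) :
    |∫ t in (0 : ℝ)..s, φ t| ≤ C * (1 + |s|) ^ (a + 1) := by
  have := intervalIntegral.norm_integral_le_of_norm_le_const (a := 0) (b := s) (f := φ)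
    (C := C * (1 + |s|) ^ a) fun t ht ↦ (h t).trans <| by
      have := abs_le_of_mem_uIcc (Set.uIoc_subset_uIcc ht)
      have h2 : 1 + |t| ≤ 1 + |s| := by linarith
      gcongr C * ?_
      exact Real.rpow_le_rpow (by positivity) h2 ha
  rw [Real.norm_eq_abs, sub_zero] at this
  refine this.trans ?_
  rw [Real.rpow_add_one (by positivity), ← mul_assoc]
  gcongr
  linarith

theorem g_intervalIntegrable {p q μ : ℝ} (hp : 1 < p) (hq : 0 < q) (hμ : 0 < μ) (x y : ℝ) :
    IntervalIntegrable (g p q μ) volume x y := by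
  obtain ⟨C, -, h⟩ := exists_abs_g_le (ε := p - 1) hp hq hμ (by linarith) le_rfl
  exact intervalIntegrable_of_growth (measurable_g p q μ) (by linarith) h x y

theorem continuous_G {p q μ : ℝ} (hp : 1 < p) (hq : 0 < q) (hμ : 0 < μ) :
    Continuous (G p q μ) :=
  intervalIntegral.continuous_primitive (g_intervalIntegrable hp hq hμ) 0

theorem continuous_F {p μ : ℝ} (hp : 1 < p) (hμ : 0 < μ) : Continuous (F p μ) := by
  obtain ⟨C, -, h⟩ := exists_abs_f_le hp hμ
  exact intervalIntegral.continuous_primitive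
    (intervalIntegrable_of_growth (measurable_f p μ) (by linarith) h) 0

theorem exists_abs_G_le {p q μ r : ℝ} (hp : 1 < p) (hq : 0 < q) (hμ : 0 < μ) (hr : p < r)
    (hrp : r ≤ 2 * p - 1) :
    ∃ C, 0 ≤ C ∧ ∀ s, |G p q μ s| ≤ C * (1 + |s|) ^ r := by
  obtain ⟨C, hC, h⟩ := exists_abs_g_le (ε := r - p) hp hq hμ (by linarith) (by linarith)
  refine ⟨C, hC, fun s ↦ (abs_primitive_le_of_growth hC (by linarith) h s).trans_eq ?_⟩
  congr 2
  ring

theorem exists_abs_F_le {p μ : ℝ} (hp : 1 < p) (hμ : 0 < μ) :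
    ∃ C, 0 ≤ C ∧ ∀ s, |F p μ s| ≤ C * (1 + |s|) ^ p := by
  obtain ⟨C, hC, h⟩ := exists_abs_f_le hp hμ
  refine ⟨C, hC, fun s ↦ (abs_primitive_le_of_growth hC (by linarith) h s).trans_eq ?_⟩
  congr 2
  ring

/-! ### Behaviour of `G` on the positive half line -/

theorem g_eq_of_nonneg {p q μ s : ℝ} (hq : 0 < q) (hμ : 0 < μ) (hs : 0 ≤ s) :
    g p q μ s = (p - 1) ^ (q - p + 1) / μ ^ q * (1 + μ * s) ^ (p - 1)
      * Real.log (1 + μ * s) ^ q := by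
  have h0 : -1 / μ < s := lt_of_lt_of_le (div_neg_of_neg_of_pos (by norm_num) hμ) hs
  have hl : 0 ≤ Real.log (1 + μ * s) := Real.log_nonneg (by nlinarith)
  rw [g, if_pos h0, mul_assoc, abs_of_nonneg hl]
  congr 1
  rcases hl.eq_or_lt with h | h
  · rw [← h, mul_zero, Real.zero_rpow hq.ne']
  · rw [← Real.rpow_add_one h.ne']; simp

theorem g_monotoneOn {p q μ : ℝ} (hp : 1 < p) (hq : 0 < q) (hμ : 0 < μ) :
    MonotoneOn (g p q μ) (Set.Ici 0) := by
  intro s hs t ht hst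
  rw [g_eq_of_nonneg hq hμ hs, g_eq_of_nonneg hq hμ ht]
  have hs' : (0 : ℝ) ≤ s := hs
  have hp' : 0 < p - 1 := by linarith
  have ht' : (0 : ℝ) ≤ t := ht
  have : 0 ≤ Real.log (1 + μ * s) := Real.log_nonneg (by nlinarith)
  have hC : 0 ≤ (p - 1) ^ (q - p + 1) / μ ^ q := by positivity
  gcongr

theorem g_nonneg {p q μ s : ℝ} (hp : 1 < p) (hq : 0 < q) (hμ : 0 < μ) (hs : 0 ≤ s) :
    0 ≤ g p q μ s := by
  rw [g_eq_of_nonneg hq hμ hs]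
  have hp' : 0 < p - 1 := by linarith
  have : 0 ≤ Real.log (1 + μ * s) := Real.log_nonneg (by nlinarith)
  positivity

theorem G_sub_G {p q μ : ℝ} (hp : 1 < p) (hq : 0 < q) (hμ : 0 < μ) (s t : ℝ) :
    G p q μ t - G p q μ s = ∫ x in s..t, g p q μ x := by
  have := g_intervalIntegrable hp hq hμ
  exact intervalIntegral.integral_interval_sub_left (this _ _) (this _ _)

theorem G_monotoneOn {p q μ : ℝ} (hp : 1 < p) (hq : 0 < q) (hμ : 0 < μ) :
    MonotoneOn (G p q μ) (Set.Ici 0) := by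
  intro s hs t ht hst
  rw [← sub_nonneg, G_sub_G hp hq hμ]
  exact intervalIntegral.integral_nonneg hst fun x hx ↦
    g_nonneg hp hq hμ (le_trans hs hx.1)

theorem G_nonneg {p q μ s : ℝ} (hp : 1 < p) (hq : 0 < q) (hμ : 0 < μ) (hs : 0 ≤ s) :
    0 ≤ G p q μ s :=
  intervalIntegral.integral_nonneg hs fun _ hx ↦ g_nonneg hp hq hμ hx.1

/-- Monotonicity bounds the integrand below by its value at `s/2` on `[s/2, s]`; the integral over
`[0, s/2]` is nonnegative and is dropped. -/
theorem half_mul_g_half_le_G {p q μ s : ℝ} (hp : 1 < p) (hq : 0 < q) (hμ : 0 < μ) (hs : 0 ≤ s) :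
    s / 2 * g p q μ (s / 2) ≤ G p q μ s := by
  have h1 : s / 2 * g p q μ (s / 2) ≤ G p q μ s - G p q μ (s / 2) := by
    rw [G_sub_G hp hq hμ]
    have := intervalIntegral.integral_mono_on (μ := volume) (a := s / 2) (b := s)
      (f := fun _ ↦ g p q μ (s / 2)) (by linarith) (by simp) (g_intervalIntegrable hp hq hμ _ _)
      fun x hx ↦ g_monotoneOn hp hq hμ (by simp; linarith) (by simp; linarith [hx.1]) hx.1
    rw [intervalIntegral.integral_const, smul_eq_mul] at this
    linarith
  linarith [G_nonneg hp hq hμ (s := s / 2) (by linarith)]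

/-- `G` grows faster than the `p`-th power. -/
theorem tendsto_G_mul_div_rpow {p q μ η : ℝ} (hp : 1 < p) (hq : 0 < q) (hμ : 0 < μ)
    (hη : 0 < η) :
    Tendsto (fun t ↦ G p q μ (t * η) / t ^ p) atTop atTop := by
  have hp' : 0 < p - 1 := by linarith
  have hlog : Tendsto (fun t : ℝ ↦ Real.log (1 + μ * (t * η / 2)) ^ q) atTop atTop := by
    refine (tendsto_rpow_atTop hq).comp (Real.tendsto_log_atTop.comp ?_)
    refine tendsto_atTop_add_const_left _ _ (Tendsto.const_mul_atTop hμ ?_)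
    exact (tendsto_id.atTop_mul_const hη).atTop_div_const two_pos
  -- The coefficient left when `1 + u` is replaced by `u` in the power factor of `(tη/2) g(tη/2)`
  -- and `t^p` is pulled out; only the logarithm still depends on `t`.
  have hK : 0 < (η / 2) * ((p - 1) ^ (q - p + 1) / μ ^ q * (μ * (η / 2)) ^ (p - 1)) := by
    positivity
  refine tendsto_atTop_mono' _ ?_ (hlog.const_mul_atTop hK)
  filter_upwards [eventually_gt_atTop 0] with t ht
  rw [le_div_iff₀ (by positivity)]
  have hpow : t ^ p = t ^ (p - 1) * t := by rw [← Real.rpow_add_one ht.ne']; simp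
  have hlog0 : 0 ≤ Real.log (1 + μ * (t * η / 2)) := Real.log_nonneg (by
    have : 0 < μ * (t * η / 2) := by positivity
    linarith)
  calc _ = t * η / 2 * ((p - 1) ^ (q - p + 1) / μ ^ q * (μ * (t * η / 2)) ^ (p - 1)
        * Real.log (1 + μ * (t * η / 2)) ^ q) := by
        rw [show (μ * (t * η / 2)) ^ (p - 1) = (μ * (η / 2)) ^ (p - 1) * t ^ (p - 1) by
          rw [← Real.mul_rpow (by positivity) ht.le]; congr 1; ring, hpow]
        ring
    _ ≤ t * η / 2 * g p q μ (t * η / 2) := by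
        rw [g_eq_of_nonneg hq hμ (by positivity)]
        gcongr
        linarith
    _ ≤ _ := half_mul_g_half_le_G hp hq hμ (by positivity)

end PGradient

namespace PGradient

/-! ### Structure of `W_0^{1,p}` and the Sobolev inequality -/

section Space

variable {N : ℕ} {Ω : Set (EuclideanSpace ℝ (Fin N))} {p : ℝ}

theorem norm_gradient_eq (φ : EuclideanSpace ℝ (Fin N) → ℝ) (x : EuclideanSpace ℝ (Fin N)) :
    ‖gradient φ x‖ = ‖fderiv ℝ φ x‖ := by
  rw [← toDual_gradient (𝕜 := ℝ), LinearIsometryEquiv.norm_map]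

theorem gradient_add_eq {φ ψ : EuclideanSpace ℝ (Fin N) → ℝ} (hφ : Differentiable ℝ φ)
    (hψ : Differentiable ℝ ψ) : gradient (φ + ψ) = gradient φ + gradient ψ := by
  ext1 x
  simp [gradient, fderiv_add (hφ x) (hψ x)]

theorem gradient_smul_eq {φ : EuclideanSpace ℝ (Fin N) → ℝ} (a : ℝ) (hφ : Differentiable ℝ φ) :
    gradient (a • φ) = a • gradient φ := by
  ext1 x
  simp [gradient, fderiv_const_smul (hφ x) a]

theorem IsTestFunction.differentiable {φ : EuclideanSpace ℝ (Fin N) → ℝ}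
    (hφ : IsTestFunction Ω φ) : Differentiable ℝ φ :=
  hφ.1.differentiable (by simp)

theorem IsTestFunction.continuous_gradient {φ : EuclideanSpace ℝ (Fin N) → ℝ}
    (hφ : IsTestFunction Ω φ) : Continuous (gradient φ) :=
  (LinearIsometryEquiv.continuous _).comp (hφ.1.continuous_fderiv (by simp))

theorem support_gradient_subset (φ : EuclideanSpace ℝ (Fin N) → ℝ) :
    Function.support (gradient φ) ⊆ tsupport φ := by
  intro x hx
  refine support_fderiv_subset ℝ (f := φ) ?_
  rw [Function.mem_support, ← norm_ne_zero_iff] at hx ⊢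
  rwa [← norm_gradient_eq]

theorem IsTestFunction.hasCompactSupport_gradient {φ : EuclideanSpace ℝ (Fin N) → ℝ}
    (hφ : IsTestFunction Ω φ) : HasCompactSupport (gradient φ) :=
  hφ.2.1.mono' (support_gradient_subset φ)

/-- Test pairs are already closed under linear combinations, so elements of `W01p` are limits of
genuine test pairs and density arguments apply. -/
theorem mem_span_testPairs_iff
    {z : Lp ℝ (ENNReal.ofReal p) (volume.restrict Ω) ×
      Lp (EuclideanSpace ℝ (Fin N)) (ENNReal.ofReal p) (volume.restrict Ω)} :
    z ∈ Submodule.span ℝ (testPairs Ω p) ↔ z ∈ testPairs Ω p := by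
  refine ⟨fun hz ↦ ?_, fun hz ↦ Submodule.subset_span hz⟩
  induction hz using Submodule.span_induction with
  | mem x hx => exact hx
  | zero =>
    refine ⟨0, ⟨contDiff_const, HasCompactSupport.zero, by simp [tsupport]⟩, Lp.coeFn_zero _ _ _, ?_⟩
    have : gradient (0 : EuclideanSpace ℝ (Fin N) → ℝ) = 0 := by
      ext1 x; simp [gradient]
    rw [this]
    exact Lp.coeFn_zero _ _ _
  | add x y _ _ hx hy =>
    obtain ⟨φ, hφ, h1, h2⟩ := hx
    obtain ⟨ψ, hψ, h3, h4⟩ := hy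
    refine ⟨φ + ψ, ⟨hφ.1.add hψ.1, hφ.2.1.add hψ.2.1, ?_⟩, ?_, ?_⟩
    · exact (tsupport_add φ ψ).trans (Set.union_subset hφ.2.2 hψ.2.2)
    · exact (Lp.coeFn_add _ _).trans (h1.add h3)
    · rw [gradient_add_eq hφ.differentiable hψ.differentiable]
      exact (Lp.coeFn_add _ _).trans (h2.add h4)
  | smul a x _ hx =>
    obtain ⟨φ, hφ, h1, h2⟩ := hx
    refine ⟨a • φ, ⟨contDiff_const.smul hφ.1, hφ.2.1.smul_left (f := fun _ ↦ a), ?_⟩, ?_, ?_⟩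
    · exact (closure_mono (Function.support_const_smul_subset a φ)).trans hφ.2.2
    · exact (Lp.coeFn_smul _ _).trans (h1.const_smul a)
    · rw [gradient_smul_eq a hφ.differentiable]
      exact (Lp.coeFn_smul _ _).trans (h2.const_smul a)

variable [Fact (1 < p)]

theorem IsTestFunction.exists_mem {φ : EuclideanSpace ℝ (Fin N) → ℝ} (hφ : IsTestFunction Ω φ) :
    ∃ v : W01p Ω p, fn v =ᵐ[volume.restrict Ω] φ := by
  have h1 : MemLp φ (ENNReal.ofReal p) (volume.restrict Ω) :=
    (hφ.1.continuous.memLp_of_hasCompactSupport hφ.2.1).restrict _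
  have h2 : MemLp (gradient φ) (ENNReal.ofReal p) (volume.restrict Ω) :=
    (hφ.continuous_gradient.memLp_of_hasCompactSupport hφ.hasCompactSupport_gradient).restrict _
  refine ⟨⟨(h1.toLp φ, h2.toLp _), Submodule.le_topologicalClosure _ (Submodule.subset_span
    ⟨φ, hφ, h1.coeFn_toLp, h2.coeFn_toLp⟩)⟩, h1.coeFn_toLp⟩

theorem poincareNorm_eq_norm (v : W01p Ω p) : poincareNorm v = ‖v.1.2‖ := by
  have hp : 1 < p := Fact.out
  rw [Lp.norm_def, (Lp.memLp v.1.2).eLpNorm_eq_integral_rpow_norm (by simpa using by linarith)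
    ENNReal.ofReal_ne_top, ENNReal.toReal_ofReal (by positivity),
    ENNReal.toReal_ofReal (by positivity), poincareNorm, one_div]
  rfl

theorem poincareNorm_nonneg (v : W01p Ω p) : 0 ≤ poincareNorm v := by
  rw [poincareNorm_eq_norm]
  exact norm_nonneg _

theorem integral_norm_grad_rpow (v : W01p Ω p) :
    ∫ x in Ω, ‖grad v x‖ ^ p = poincareNorm v ^ p := by
  have hp : 1 < p := Fact.out
  rw [poincareNorm, ← Real.rpow_mul (by positivity), one_div, inv_mul_cancel₀ (by linarith),
    Real.rpow_one]

theorem poincareNorm_smul (t : ℝ) (v : W01p Ω p) :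
    poincareNorm (t • v) = |t| * poincareNorm v := by
  rw [poincareNorm_eq_norm, poincareNorm_eq_norm]
  exact norm_smul t v.1.2

theorem fn_smul (t : ℝ) (v : W01p Ω p) :
    ∀ᵐ x ∂volume.restrict Ω, fn (t • v) x = t * fn v x :=
  Lp.coeFn_smul t v.1.1

theorem aestronglyMeasurable_fn (v : W01p Ω p) :
    AEStronglyMeasurable (fn v) (volume.restrict Ω) :=
  Lp.aestronglyMeasurable v.1.1

/-- The Gagliardo–Nirenberg–Sobolev inequality on a bounded set; the condition on `m` says that it
is at most the critical exponent `Np/(N-p)`. Supports inside `Ω` make norms over `Ω` and over the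
whole space agree. -/
theorem exists_sobolev_testFunction (hΩb : Bornology.IsBounded Ω) (hpN : p < N) {m : ℝ}
    (hm : 0 < m) (hpm : p⁻¹ - (N : ℝ)⁻¹ ≤ m⁻¹) :
    ∃ C : NNReal, ∀ φ : EuclideanSpace ℝ (Fin N) → ℝ, IsTestFunction Ω φ →
      eLpNorm φ (ENNReal.ofReal m) (volume.restrict Ω) ≤
        C * eLpNorm (gradient φ) (ENNReal.ofReal p) (volume.restrict Ω) := by
  have hp : 1 < p := Fact.out
  refine ⟨eLpNormLESNormFDerivOfLeConst ℝ volume Ω p.toNNReal m.toNNReal, fun φ hφ ↦ ?_⟩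
  have hs := subset_tsupport φ
  have key := eLpNorm_le_eLpNorm_fderiv_of_le (μ := volume) (s := Ω)
    (p := p.toNNReal) (q := m.toNNReal) (hφ.1.of_le (by simp)) (hs.trans hφ.2.2)
    (by simpa using hp.le) (by simpa [← NNReal.coe_lt_coe, hp.le, (by linarith : 0 ≤ p)] using hpN)
    (by simpa [hm.le, (by linarith : 0 ≤ p)] using hpm) hΩb
  rw [eLpNorm_restrict_eq_of_support_subset (hs.trans hφ.2.2),
    eLpNorm_restrict_eq_of_support_subset ((support_gradient_subset φ).trans hφ.2.2),
    eLpNorm_congr_norm_ae (Eventually.of_forall (norm_gradient_eq φ))]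
  exact key

/-- The Sobolev inequality on `W_0^{1,p}(Ω)`. -/
theorem exists_sobolev (hΩb : Bornology.IsBounded Ω) (hpN : p < N) {m : ℝ}
    (hm : 0 < m) (hpm : p⁻¹ - (N : ℝ)⁻¹ ≤ m⁻¹) :
    ∃ C : NNReal, ∀ v : W01p Ω p, eLpNorm (fn v) (ENNReal.ofReal m) (volume.restrict Ω) ≤
      C * ENNReal.ofReal (poincareNorm v) := by
  obtain ⟨C, hC⟩ := exists_sobolev_testFunction hΩb hpN hm hpm
  refine ⟨C, fun v ↦ ?_⟩
  obtain ⟨z, hz, hlim⟩ := mem_closure_iff_seq_limit.1 v.2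
  have hbound : ∀ n, eLpNorm (z n).1 (ENNReal.ofReal m) (volume.restrict Ω) ≤
      C * ENNReal.ofReal ‖(z n).2‖ := by
    intro n
    obtain ⟨φ, hφ, h1, h2⟩ := mem_span_testPairs_iff.1 (hz n)
    rw [Lp.norm_def, ENNReal.ofReal_toReal (Lp.eLpNorm_ne_top _), eLpNorm_congr_ae h1,
      eLpNorm_congr_ae h2]
    exact hC φ hφ
  have hlim1 := (continuous_fst.tendsto _).comp hlim
  have hlim2 := ((continuous_snd.norm).tendsto _).comp hlim
  rw [poincareNorm_eq_norm]
  have hlim3 : Tendsto (fun n ↦ (C : ℝ≥0∞) * ENNReal.ofReal ‖(z n).2‖) atTop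
      (𝓝 (C * ENNReal.ofReal ‖v.1.2‖)) :=
    ENNReal.Tendsto.const_mul ((ENNReal.continuous_ofReal.tendsto _).comp hlim2)
      (Or.inr ENNReal.coe_ne_top)
  -- An almost everywhere convergent subsequence is enough: by Fatou the `L^m` norm is lower
  -- semicontinuous along it, while the gradient norms converge.
  obtain ⟨ns, hns, hae⟩ := (tendstoInMeasure_of_tendsto_Lp hlim1).exists_seq_tendsto_ae
  calc eLpNorm (fn v) (ENNReal.ofReal m) (volume.restrict Ω)
      ≤ atTop.liminf fun n ↦ eLpNorm (z (ns n)).1 (ENNReal.ofReal m) (volume.restrict Ω) :=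
        Lp.eLpNorm_lim_le_liminf_eLpNorm (fun n ↦ Lp.aestronglyMeasurable (z (ns n)).1) _ hae
    _ ≤ atTop.liminf fun n ↦ (C : ℝ≥0∞) * ENNReal.ofReal ‖(z (ns n)).2‖ :=
        liminf_le_liminf (Eventually.of_forall fun n ↦ hbound (ns n))
    _ = _ := (hlim3.comp hns.tendsto_atTop).liminf_eq

/-- The case `m = p` of the Sobolev inequality, which is Poincaré's. -/
theorem fn_ae_eq_zero_of_poincareNorm_eq_zero (hΩb : Bornology.IsBounded Ω) (hpN : p < N)
    {v : W01p Ω p} (hv : poincareNorm v = 0) : ∀ᵐ x ∂volume.restrict Ω, fn v x = 0 := by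
  have hp : 1 < p := Fact.out
  obtain ⟨C, hC⟩ := exists_sobolev (Ω := Ω) (p := p) hΩb hpN (m := p) (by linarith)
    (by simp)
  have h := hC v
  rw [hv, ENNReal.ofReal_zero, mul_zero, nonpos_iff_eq_zero,
    eLpNorm_eq_zero_iff (aestronglyMeasurable_fn v) (by simpa using by linarith)] at h
  exact h

theorem exists_eLpNorm_one_add_abs_le (hΩb : Bornology.IsBounded Ω) (hpN : p < N) {m : ℝ}
    (hm : 1 ≤ m) (hpm : p⁻¹ - (N : ℝ)⁻¹ ≤ m⁻¹) :
    ∃ A : ℝ, 0 ≤ A ∧ ∀ v : W01p Ω p,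
      eLpNorm (fun x ↦ 1 + |fn v x|) (ENNReal.ofReal m) (volume.restrict Ω) ≤
        ENNReal.ofReal (A * (1 + poincareNorm v)) := by
  have : IsFiniteMeasure (volume.restrict Ω) := ⟨by simpa using hΩb.measure_lt_top⟩
  obtain ⟨C, hC⟩ := exists_sobolev (Ω := Ω) (p := p) hΩb hpN (by linarith) hpm
  have h1 : MemLp (fun _ : EuclideanSpace ℝ (Fin N) ↦ (1 : ℝ)) (ENNReal.ofReal m)
    (volume.restrict Ω) := memLp_const 1
  set B := eLpNorm (fun _ : EuclideanSpace ℝ (Fin N) ↦ (1 : ℝ)) (ENNReal.ofReal m)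
    (volume.restrict Ω) with hB
  refine ⟨B.toReal + C, by positivity, fun v ↦ ?_⟩
  have h0 := poincareNorm_nonneg v
  have habs : eLpNorm (fun x ↦ |fn v x|) (ENNReal.ofReal m) (volume.restrict Ω) =
      eLpNorm (fn v) (ENNReal.ofReal m) (volume.restrict Ω) := by
    simpa only [Real.norm_eq_abs] using eLpNorm_norm (fn v)
  have hmeas : AEStronglyMeasurable (fun x ↦ |fn v x|) (volume.restrict Ω) := by
    simpa only [Real.norm_eq_abs] using (aestronglyMeasurable_fn v).norm
  calc _ ≤ B + eLpNorm (fun x ↦ |fn v x|) (ENNReal.ofReal m) (volume.restrict Ω) :=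
        eLpNorm_add_le h1.1 hmeas (by simpa using hm)
    _ = B + eLpNorm (fn v) (ENNReal.ofReal m) (volume.restrict Ω) := by
        rw [habs]
    _ ≤ ENNReal.ofReal B.toReal + ENNReal.ofReal (C * poincareNorm v) := by
        rw [ENNReal.ofReal_toReal h1.eLpNorm_ne_top, ENNReal.ofReal_mul (by positivity),
          ENNReal.ofReal_coe_nnreal]
        gcongr
        exact hC v
    _ = ENNReal.ofReal (B.toReal + C * poincareNorm v) :=
        (ENNReal.ofReal_add (by positivity) (by positivity)).symm
    _ ≤ _ := by
        apply ENNReal.ofReal_le_ofReal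
        have : 0 ≤ B.toReal * poincareNorm v := by positivity
        have hC0 := C.coe_nonneg
        linarith [add_mul B.toReal (C : ℝ) (1 + poincareNorm v),
          mul_add B.toReal 1 (poincareNorm v), mul_add (C : ℝ) 1 (poincareNorm v)]

end Space

end PGradient

namespace PGradient

/-! ### Estimates of the lower order terms -/

section Functional

variable {N : ℕ} {Ω : Set (EuclideanSpace ℝ (Fin N))} {p : ℝ} [Fact (1 < p)]

/-- Hölder with exponents `k, k'`, where the `L^k'` norm of `w^r` is the `r`-th power of the
`L^(k'r)` norm of `w`. That `A` is chosen before `c` and `v` is what later makes `δ` uniform. -/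
theorem exists_integral_weight_mul_rpow_le (hΩb : Bornology.IsBounded Ω) (hpN : p < N)
    {k k' r : ℝ} (hk : k.HolderConjugate k') (hr : 1 ≤ r) (hpr : p⁻¹ - (N : ℝ)⁻¹ ≤ (k' * r)⁻¹) :
    ∃ A : ℝ, 0 ≤ A ∧ ∀ c : EuclideanSpace ℝ (Fin N) → ℝ,
      MemLp c (ENNReal.ofReal k) (volume.restrict Ω) → ∀ v : W01p Ω p,
        IntegrableOn (fun x ↦ |c x| * (1 + |fn v x|) ^ r) Ω ∧
        ∫ x in Ω, |c x| * (1 + |fn v x|) ^ r ≤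
          (eLpNorm c (ENNReal.ofReal k) (volume.restrict Ω)).toReal *
            (A * (1 + poincareNorm v)) ^ r := by
  have hk' : 1 < k' := hk.symm.lt
  obtain ⟨A, hA, hbd⟩ := exists_eLpNorm_one_add_abs_le (Ω := Ω) (p := p) hΩb hpN
    (m := k' * r) (by nlinarith) hpr
  refine ⟨A, hA, fun c hc v ↦ ?_⟩
  have h0 := poincareNorm_nonneg v
  have hmeas : AEStronglyMeasurable (fun x ↦ 1 + |fn v x|) (volume.restrict Ω) := by
    simpa only [Real.norm_eq_abs] using (aestronglyMeasurable_fn v).norm.const_add (1 : ℝ)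
  have hwm : AEStronglyMeasurable (fun x ↦ (1 + |fn v x|) ^ r) (volume.restrict Ω) :=
    (hmeas.aemeasurable.pow_const r).aestronglyMeasurable
  have hw : eLpNorm (fun x ↦ (1 + |fn v x|) ^ r) (ENNReal.ofReal k') (volume.restrict Ω) ≤
      ENNReal.ofReal ((A * (1 + poincareNorm v)) ^ r) := by
    have h1 : (fun x ↦ (1 + |fn v x|) ^ r) = fun x ↦ ‖1 + |fn v x|‖ ^ r := by
      ext x
      rw [Real.norm_of_nonneg (by positivity)]
    rw [h1, eLpNorm_norm_rpow _ (by linarith), ← ENNReal.ofReal_mul (by linarith),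
      ← ENNReal.ofReal_rpow_of_nonneg (by positivity) (by linarith)]
    exact ENNReal.rpow_le_rpow (hbd v) (by linarith)
  have hwLp : MemLp (fun x ↦ (1 + |fn v x|) ^ r) (ENNReal.ofReal k') (volume.restrict Ω) :=
    ⟨hwm, hw.trans_lt ENNReal.ofReal_lt_top⟩
  have := hk.ennrealOfReal
  have hcabs : MemLp (fun x ↦ |c x|) (ENNReal.ofReal k) (volume.restrict Ω) := hc.norm
  have hint : IntegrableOn (fun x ↦ |c x| * (1 + |fn v x|) ^ r) Ω :=
    memLp_one_iff_integrable.1 (hwLp.mul' hcabs)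
  refine ⟨hint, ?_⟩
  have hnn : ∀ x, 0 ≤ |c x| * (1 + |fn v x|) ^ r := fun x ↦ by positivity
  have hcn : eLpNorm (fun x ↦ |c x|) (ENNReal.ofReal k) (volume.restrict Ω) =
      eLpNorm c (ENNReal.ofReal k) (volume.restrict Ω) := eLpNorm_norm c
  have hholder := eLpNorm_smul_le_mul_eLpNorm (p := ENNReal.ofReal k)
    (q := ENNReal.ofReal k') (r := 1) hwLp.1 hcabs.1
  rw [hcn, eLpNorm_one_eq_lintegral_enorm] at hholder
  have heq : ∫ x in Ω, |c x| * (1 + |fn v x|) ^ r =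
      (∫⁻ x in Ω, ‖|c x| * (1 + |fn v x|) ^ r‖ₑ).toReal := by
    rw [← integral_norm_eq_lintegral_enorm hint.1]
    simp_rw [Real.norm_of_nonneg (hnn _)]
  rw [heq]
  have hR : 0 ≤ (A * (1 + poincareNorm v)) ^ r := by positivity
  rw [← ENNReal.toReal_ofReal hR, ← ENNReal.toReal_mul]
  refine ENNReal.toReal_mono (ENNReal.mul_ne_top hc.eLpNorm_ne_top ENNReal.ofReal_ne_top) ?_
  exact hholder.trans (by gcongr)

theorem integrableOn_and_abs_integral_le_of_growth {ψ : ℝ → ℝ} {C r : ℝ} (hψ : Continuous ψ)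
    (hgrow : ∀ s, |ψ s| ≤ C * (1 + |s|) ^ r) {c : EuclideanSpace ℝ (Fin N) → ℝ}
    (hc : AEStronglyMeasurable c (volume.restrict Ω)) {v : W01p Ω p}
    (hint : IntegrableOn (fun x ↦ |c x| * (1 + |fn v x|) ^ r) Ω) :
    IntegrableOn (fun x ↦ c x * ψ (fn v x)) Ω ∧
      |∫ x in Ω, c x * ψ (fn v x)| ≤ C * ∫ x in Ω, |c x| * (1 + |fn v x|) ^ r := by
  have hle : ∀ x, ‖c x * ψ (fn v x)‖ ≤ C * (|c x| * (1 + |fn v x|) ^ r) := fun x ↦ by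
    rw [norm_mul, Real.norm_eq_abs, Real.norm_eq_abs]
    calc |c x| * |ψ (fn v x)| ≤ |c x| * (C * (1 + |fn v x|) ^ r) := by
          gcongr
          exact hgrow _
      _ = _ := by ring
  refine ⟨(hint.const_mul C).mono' (hc.mul (hψ.comp_aestronglyMeasurable
    (aestronglyMeasurable_fn v))) (Eventually.of_forall hle), ?_⟩
  rw [← integral_const_mul]
  exact norm_integral_le_of_norm_le (hint.const_mul C) (Eventually.of_forall hle)

/-! ### Divergence of the functional along nonnegative directions -/

/-- The set where `c` and `w` are both positive is the countable union of these sets with `η =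
1/(n+1)`; they cannot all be null. -/
theorem exists_pos_measure_le_and_le {α : Type*} [MeasurableSpace α] {ν : Measure α}
    {c w : α → ℝ} (hc : ∀ᵐ x ∂ν, 0 ≤ c x) (hw : ∀ᵐ x ∂ν, 0 ≤ w x)
    (hcw : ¬ ∀ᵐ x ∂ν, c x * w x = 0) :
    ∃ η : ℝ, 0 < η ∧ ν {x | η ≤ c x ∧ η ≤ w x} ≠ 0 := by
  by_contra! hcon
  refine hcw ?_
  have h1 : ∀ᵐ x ∂ν, ∀ n : ℕ, ¬ (1 / ((n : ℝ) + 1) ≤ c x ∧ 1 / ((n : ℝ) + 1) ≤ w x) := by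
    rw [ae_all_iff]
    intro n
    simpa [ae_iff] using hcon (1 / ((n : ℝ) + 1)) (by positivity)
  filter_upwards [hc, hw, h1] with x hcx hwx hx
  by_contra hne
  have hcx' : 0 < c x := hcx.lt_of_ne fun h ↦ hne (by rw [← h, zero_mul])
  have hwx' : 0 < w x := hwx.lt_of_ne fun h ↦ hne (by rw [← h, mul_zero])
  obtain ⟨n, hn⟩ := exists_nat_one_div_lt (lt_min hcx' hwx')
  exact hx n ⟨(hn.trans_le (min_le_left _ _)).le, (hn.trans_le (min_le_right _ _)).le⟩

/-- Markov's inequality: where `c ≥ η` and `v ≥ η`, monotonicity of `G` gives `c G(tv) ≥ η G(tη)`.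
-/
theorem mul_G_le_integral_smul (hΩb : Bornology.IsBounded Ω) {q μ η t : ℝ} (hq : 0 < q)
    (hμ : 0 < μ) (hη : 0 < η) (ht : 0 ≤ t) {c : EuclideanSpace ℝ (Fin N) → ℝ}
    (hc0 : ∀ᵐ x ∂volume.restrict Ω, 0 ≤ c x) {v : W01p Ω p}
    (hcG : IntegrableOn (fun x ↦ c x * G p q μ (fn (t • v) x)) Ω)
    (hv : ∀ᵐ x ∂volume.restrict Ω, 0 ≤ fn v x) :
    η * (volume.restrict Ω).real {x | η ≤ c x ∧ η ≤ fn v x} * G p q μ (t * η) ≤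
      ∫ x in Ω, c x * G p q μ (fn (t • v) x) := by
  have hp : 1 < p := Fact.out
  have : IsFiniteMeasure (volume.restrict Ω) := ⟨by simpa using hΩb.measure_lt_top⟩
  have hG0 : 0 ≤ G p q μ (t * η) := G_nonneg hp hq hμ (by positivity)
  have hnn : 0 ≤ᵐ[volume.restrict Ω] fun x ↦ c x * G p q μ (fn (t • v) x) := by
    filter_upwards [hc0, hv, fn_smul t v] with x hcx hvx hx
    rw [hx]
    exact mul_nonneg hcx (G_nonneg hp hq hμ (mul_nonneg ht hvx))
  refine le_trans ?_ (mul_meas_ge_le_integral_of_nonneg hnn hcG (η * G p q μ (t * η)))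
  have hsub : (volume.restrict Ω).real {x | η ≤ c x ∧ η ≤ fn v x} ≤ (volume.restrict Ω).real
      {x | η * G p q μ (t * η) ≤ c x * G p q μ (fn (t • v) x)} := by
    refine ENNReal.toReal_mono (measure_ne_top _ _) (measure_mono_ae ?_)
    filter_upwards [hv, fn_smul t v] with x hvx hx hxE
    obtain ⟨h1, h2⟩ : η ≤ c x ∧ η ≤ fn v x := hxE
    change η * G p q μ (t * η) ≤ c x * G p q μ (fn (t • v) x)
    rw [hx]
    have hmono : G p q μ (t * η) ≤ G p q μ (t * fn v x) :=
      G_monotoneOn hp hq hμ (mul_nonneg ht hη.le : (0 : ℝ) ≤ _) (mul_nonneg ht hvx : (0 : ℝ) ≤ _)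
        (by gcongr)
    exact mul_le_mul h1 hmono hG0 (hη.le.trans h1)
  calc _ = η * G p q μ (t * η) * (volume.restrict Ω).real {x | η ≤ c x ∧ η ≤ fn v x} := by ring
    _ ≤ _ := by gcongr

/-- Since `1 + |tv| ≤ t(1 + |v|)` for `t ≥ 1`, growth of order exactly `p` keeps this term at the
order `t^p` of the gradient term; `r` enters only through the integrable majorant. -/
theorem abs_integral_F_smul_le {μ r C t : ℝ} (hpr : p ≤ r) (hC : 0 ≤ C)
    (hF : ∀ s, |F p μ s| ≤ C * (1 + |s|) ^ p) (ht : 1 ≤ t)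
    {h : EuclideanSpace ℝ (Fin N) → ℝ} {v : W01p Ω p}
    (hhint : IntegrableOn (fun x ↦ |h x| * (1 + |fn v x|) ^ r) Ω) :
    |∫ x in Ω, h x * F p μ (fn (t • v) x)| ≤
      t ^ p * (C * ∫ x in Ω, |h x| * (1 + |fn v x|) ^ r) := by
  have hp : 1 < p := Fact.out
  rw [← mul_assoc, ← integral_const_mul (t ^ p * C), ← Real.norm_eq_abs]
  refine norm_integral_le_of_norm_le (hhint.const_mul (t ^ p * C)) ?_
  filter_upwards [fn_smul t v] with x hx
  rw [hx, norm_mul, Real.norm_eq_abs, Real.norm_eq_abs]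
  have h1 : (1 + |t * fn v x|) ^ p ≤ t ^ p * (1 + |fn v x|) ^ r := by
    calc (1 + |t * fn v x|) ^ p ≤ (t * (1 + |fn v x|)) ^ p := by
          refine Real.rpow_le_rpow (by positivity) ?_ (by linarith)
          rw [abs_mul, abs_of_nonneg (by linarith : 0 ≤ t)]
          linarith
      _ = t ^ p * (1 + |fn v x|) ^ p := Real.mul_rpow (by linarith) (by positivity)
      _ ≤ _ := by
          gcongr
          linarith [abs_nonneg (fn v x)]
  calc |h x| * |F p μ (t * fn v x)| ≤ |h x| * (C * (1 + |t * fn v x|) ^ p) := by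
        gcongr
        exact hF _
    _ ≤ |h x| * (C * (t ^ p * (1 + |fn v x|) ^ r)) := by gcongr
    _ = _ := by ring

theorem tendsto_energy_smul_atBot (hΩb : Bornology.IsBounded Ω) {q μ r : ℝ} (hq : 0 < q)
    (hμ : 0 < μ) (hpr : p ≤ r) {c h : EuclideanSpace ℝ (Fin N) → ℝ}
    (hc0 : ∀ᵐ x ∂volume.restrict Ω, 0 ≤ c x) {v : W01p Ω p}
    (hcG : ∀ t : ℝ, IntegrableOn (fun x ↦ c x * G p q μ (fn (t • v) x)) Ω)
    (hhint : IntegrableOn (fun x ↦ |h x| * (1 + |fn v x|) ^ r) Ω)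
    (hv : ∀ᵐ x ∂volume.restrict Ω, 0 ≤ fn v x)
    (hcv : ¬ ∀ᵐ x ∂volume.restrict Ω, c x * fn v x = 0) :
    Tendsto (fun t : ℝ ↦ energy q μ c h (t • v)) atTop atBot := by
  have hp : 1 < p := Fact.out
  have : IsFiniteMeasure (volume.restrict Ω) := ⟨by simpa using hΩb.measure_lt_top⟩
  obtain ⟨η, hη, hE⟩ := exists_pos_measure_le_and_le hc0 hv hcv
  obtain ⟨C, hC, hF⟩ := exists_abs_F_le hp hμ
  obtain ⟨a, ha, haE⟩ : ∃ a, 0 < a ∧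
      a = η * (volume.restrict Ω).real {x | η ≤ c x ∧ η ≤ fn v x} :=
    ⟨_, mul_pos hη (ENNReal.toReal_pos hE (measure_ne_top _ _)), rfl⟩
  obtain ⟨K, hK⟩ : ∃ K, K = C * ∫ x in Ω, |h x| * (1 + |fn v x|) ^ r := ⟨_, rfl⟩
  obtain ⟨P, hP⟩ : ∃ P, P = 1 / p * poincareNorm v ^ p := ⟨_, rfl⟩
  have hbr : Tendsto (fun t : ℝ ↦ (P + K) - a * (G p q μ (t * η) / t ^ p)) atTop atBot := by
    have h1 := (tendsto_G_mul_div_rpow hp hq hμ hη).const_mul_atTop ha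
    have h2 := tendsto_atBot_add_const_left atTop (P + K) (tendsto_neg_atTop_atBot.comp h1)
    simpa only [sub_eq_add_neg, Function.comp_apply] using h2
  refine tendsto_atBot_mono' _ ?_ hbr
  -- The energy is at most `t^p` times the bracket `(P + K) - a G(tη)/t^p`; once the bracket is
  -- nonpositive and `t^p ≥ 1`, it is at most the bracket itself.
  filter_upwards [eventually_ge_atTop 1, hbr.eventually_le_atBot 0] with t ht ht0
  have htp : 1 ≤ t ^ p := Real.one_le_rpow ht (by linarith)
  have hX : t ^ p * (G p q μ (t * η) / t ^ p) = G p q μ (t * η) :=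
    mul_div_cancel₀ _ (by linarith)
  have hgrad : 1 / p * (∫ x in Ω, ‖grad (t • v) x‖ ^ p) = t ^ p * P := by
    rw [integral_norm_grad_rpow, poincareNorm_smul, abs_of_nonneg (by linarith),
      Real.mul_rpow (by linarith) (poincareNorm_nonneg v), hP]
    ring
  have h1 := mul_G_le_integral_smul hΩb hq hμ hη (by linarith) hc0 (hcG t) hv
  have h3 := abs_integral_F_smul_le hpr hC hF ht hhint
  have h2 := neg_abs_le (∫ x in Ω, h x * F p μ (fn (t • v) x))
  rw [← haE] at h1
  rw [← hK] at h3
  rw [energy, hgrad]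
  calc _ ≤ t ^ p * ((P + K) - a * (G p q μ (t * η) / t ^ p)) := by
        have : t ^ p * ((P + K) - a * (G p q μ (t * η) / t ^ p)) =
          t ^ p * P + t ^ p * K - a * G p q μ (t * η) := by
          linear_combination -a * hX
        rw [this]
        linarith
    _ ≤ _ := by
        have := mul_nonneg_of_nonpos_of_nonpos (sub_nonpos.2 htp) ht0
        linarith

theorem exists_nonneg_mul_ne_zero (hΩo : IsOpen Ω) {c : EuclideanSpace ℝ (Fin N) → ℝ}
    (hc : ¬ ∀ᵐ x ∂volume.restrict Ω, c x = 0) :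
    ∃ v : W01p Ω p, (∀ᵐ x ∂volume.restrict Ω, 0 ≤ fn v x) ∧
      ¬ ∀ᵐ x ∂volume.restrict Ω, c x * fn v x = 0 := by
  have hpos : volume ({x | c x ≠ 0} ∩ Ω) ≠ 0 := by
    rwa [ae_iff, Measure.restrict_apply' hΩo.measurableSet] at hc
  -- Every neighbourhood of `x` meets `{c ≠ 0} ∩ Ω` in positive measure, so a bump function positive
  -- near `x` cannot be killed by `c`.
  obtain ⟨x, hx, hxt⟩ := exists_mem_forall_mem_nhdsWithin_pos_measure hpos
  obtain ⟨φ, hsupp, hcomp, hsmooth, hrange, hφx⟩ :=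
    exists_contDiff_tsupport_subset (n := ⊤) (hΩo.mem_nhds hx.2)
  have hφ : IsTestFunction Ω φ := ⟨hsmooth, hcomp, hsupp⟩
  obtain ⟨v, hv⟩ := hφ.exists_mem (p := p)
  refine ⟨v, ?_, fun hzero ↦ ?_⟩
  · filter_upwards [hv] with y hy
    rw [hy]
    exact (hrange ⟨y, rfl⟩).1
  · have hnhds : {y | 0 < φ y} ∈ 𝓝 x :=
      (isOpen_lt continuous_const hsmooth.continuous).mem_nhds (by simp [hφx])
    have h1 := hxt _ (inter_mem_nhdsWithin _ hnhds)
    refine h1.ne' ?_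
    have h2 : ∀ᵐ y ∂volume.restrict Ω, c y * φ y = 0 := by
      filter_upwards [hzero, hv] with y hy hvy
      rwa [← hvy]
    rw [ae_iff, Measure.restrict_apply' hΩo.measurableSet] at h2
    refine measure_mono_null ?_ h2
    rintro y ⟨⟨hcy, hyΩ⟩, hφy⟩
    exact ⟨mul_ne_zero hcy (ne_of_gt hφy), hyΩ⟩

theorem poincareNorm_pos (hΩb : Bornology.IsBounded Ω) (hpN : p < N)
    {c : EuclideanSpace ℝ (Fin N) → ℝ} {v : W01p Ω p}
    (hcv : ¬ ∀ᵐ x ∂volume.restrict Ω, c x * fn v x = 0) : 0 < poincareNorm v := by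
  refine (poincareNorm_nonneg v).lt_of_ne fun h0 ↦ hcv ?_
  filter_upwards [fn_ae_eq_zero_of_poincareNorm_eq_zero hΩb hpN h0.symm] with x hx
  rw [hx, mul_zero]

/-- A growth exponent above `p` that is still subcritical for weights in `L^k`. -/
theorem exists_subcritical_exponent {N p k k' : ℝ} (hp : 1 < p) (hpN : p < N) (hk : N / p < k)
    (hkk' : k.HolderConjugate k') :
    ∃ r, p < r ∧ r ≤ 2 * p - 1 ∧ p⁻¹ - N⁻¹ ≤ (k' * r)⁻¹ := by
  have hp0 : 0 < p := by linarith
  have hN0 : 0 < N := by linarith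
  have hd : 0 < p⁻¹ - N⁻¹ := by
    rw [sub_pos]
    gcongr
  have hk'0 : 0 < k' := hkk'.symm.pos
  -- The right side is the largest `r` allowed by the Sobolev condition; it exceeds `p` exactly
  -- because `1 - p/N < 1 - 1/k`. The cap `2p - 1` used below comes from the growth bound on `G`.
  have hlt : p < k'⁻¹ / (p⁻¹ - N⁻¹) := by
    rw [lt_div_iff₀ hd, mul_sub, mul_inv_cancel₀ hp0.ne', ← hkk'.one_sub_inv]
    have : k⁻¹ < p * N⁻¹ := by
      rw [← div_eq_mul_inv, ← inv_div]
      exact inv_strictAnti₀ (by positivity) hk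
    linarith
  refine ⟨min (2 * p - 1) (k'⁻¹ / (p⁻¹ - N⁻¹)), lt_min (by linarith) hlt, min_le_left _ _, ?_⟩
  have hr : 0 < min (2 * p - 1) (k'⁻¹ / (p⁻¹ - N⁻¹)) := lt_min (by linarith) (hp0.trans hlt)
  have h2 := min_le_right (2 * p - 1) (k'⁻¹ / (p⁻¹ - N⁻¹))
  rw [le_div_iff₀ hd] at h2
  rw [mul_inv, ← div_eq_mul_inv, le_div_iff₀ hr, mul_comm]
  exact h2

end Functional

end PGradient

/-! ### Choice of the threshold and mountain-pass geometry -/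

theorem proposition2p1 {N : ℕ} (hN : 3 ≤ N) (Ω : Set (EuclideanSpace ℝ (Fin N)))
    (hΩo : IsOpen Ω) (hΩb : Bornology.IsBounded Ω)
    (p : ℝ) [Fact (1 < p)] (hpN : p < N) (q : ℝ) (hq : 0 < q) (μ : ℝ) (hμ : 0 < μ)
    (k : ℝ) (hk : N / p < k) :
    ∃ δ : ℝ, 0 < δ ∧ ∀ c h : EuclideanSpace ℝ (Fin N) → ℝ,
      MemLp c (ENNReal.ofReal k) (volume.restrict Ω) →
      MemLp h (ENNReal.ofReal k) (volume.restrict Ω) →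
      (∀ᵐ x ∂volume.restrict Ω, 0 ≤ c x) →
      (¬ ∀ᵐ x ∂volume.restrict Ω, c x = 0) →
      eLpNorm c (ENNReal.ofReal k) (volume.restrict Ω) < ENNReal.ofReal δ →
      eLpNorm h (ENNReal.ofReal k) (volume.restrict Ω) < ENNReal.ofReal δ →
      -- the functional is well defined on the whole space
      (∀ v : PGradient.W01p Ω p,
        IntegrableOn (fun x => c x * PGradient.G p q μ (PGradient.fn v x)) Ω ∧
        IntegrableOn (fun x => h x * PGradient.F p μ (PGradient.fn v x)) Ω) ∧
      -- mountain-pass geometry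
      (∃ ρ : ℝ, 0 < ρ ∧
        (∃ β : ℝ, 0 < β ∧ ∀ v : PGradient.W01p Ω p, PGradient.poincareNorm v = ρ →
          β ≤ PGradient.energy q μ c h v) ∧
        ∃ v₀ : PGradient.W01p Ω p, ρ < PGradient.poincareNorm v₀ ∧ PGradient.energy q μ c h v₀ ≤ 0) ∧
      -- the functional tends to `-∞` along nonnegative directions `v` with `c v ≢ 0`
      (∀ v : PGradient.W01p Ω p, (∀ᵐ x ∂volume.restrict Ω, 0 ≤ PGradient.fn v x) →
        (¬ ∀ᵐ x ∂volume.restrict Ω, c x * PGradient.fn v x = 0) →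
        Tendsto (fun t : ℝ => PGradient.energy q μ c h (t • v)) atTop atBot) := by
  have hp : 1 < p := Fact.out
  have hp0 : 0 < p := by linarith
  have hk1 : 1 < k := lt_trans ((one_lt_div hp0).2 hpN) hk
  have hkk' := Real.HolderConjugate.conjExponent hk1
  obtain ⟨r, hpr, hr2, hrN⟩ := PGradient.exists_subcritical_exponent hp hpN hk hkk'
  obtain ⟨A, hA, hweight⟩ := PGradient.exists_integral_weight_mul_rpow_le (Ω := Ω) hΩb hpN hkk'
    (by linarith) hrN
  obtain ⟨CG, hCG, hG⟩ := PGradient.exists_abs_G_le hp hq hμ hpr hr2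
  obtain ⟨CF, hCF, hF'⟩ := PGradient.exists_abs_F_le hp hμ
  have hF : ∀ s, |PGradient.F p μ s| ≤ CF * (1 + |s|) ^ r := fun s ↦ (hF' s).trans <| by
    gcongr
    linarith [abs_nonneg s]
  -- `K` is the value of `(A(1+‖v‖))^r` on the unit sphere. The `δ` built from it gives `δ(CG + CF)K
  -- ≤ 1/(2p)`; the added `1` keeps its denominator positive.
  obtain ⟨K, hK0, hK⟩ : ∃ K, 0 ≤ K ∧ K = (A * (1 + 1)) ^ r := ⟨_, by positivity, rfl⟩
  refine ⟨1 / (2 * p * (1 + (CG + CF) * K)), by positivity, fun c h hc hh hc0 hcne hcδ hhδ ↦ ?_⟩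
  have hwell : ∀ v : PGradient.W01p Ω p,
      IntegrableOn (fun x => c x * PGradient.G p q μ (PGradient.fn v x)) Ω ∧
      IntegrableOn (fun x => h x * PGradient.F p μ (PGradient.fn v x)) Ω := fun v ↦
    ⟨(PGradient.integrableOn_and_abs_integral_le_of_growth (PGradient.continuous_G hp hq hμ) hG
      hc.1 (hweight c hc v).1).1,
    (PGradient.integrableOn_and_abs_integral_le_of_growth (PGradient.continuous_F hp hμ) hF
      hh.1 (hweight h hh v).1).1⟩
  have hlim : ∀ v : PGradient.W01p Ω p, (∀ᵐ x ∂volume.restrict Ω, 0 ≤ PGradient.fn v x) →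
      (¬ ∀ᵐ x ∂volume.restrict Ω, c x * PGradient.fn v x = 0) →
      Tendsto (fun t : ℝ => PGradient.energy q μ c h (t • v)) atTop atBot := fun v hv hcv ↦
    PGradient.tendsto_energy_smul_atBot hΩb hq hμ hpr.le hc0 (fun t ↦ (hwell (t • v)).1)
      (hweight h hh v).1 hv hcv
  refine ⟨hwell, ⟨1, one_pos, ⟨1 / (2 * p), by positivity, fun v hv ↦ ?_⟩, ?_⟩, hlim⟩
  · have hc1 := (PGradient.integrableOn_and_abs_integral_le_of_growth
      (PGradient.continuous_G hp hq hμ) hG hc.1 (hweight c hc v).1).2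
    have hh1 := (PGradient.integrableOn_and_abs_integral_le_of_growth
      (PGradient.continuous_F hp hμ) hF hh.1 (hweight h hh v).1).2
    have hc2 := (hweight c hc v).2
    have hh2 := (hweight h hh v).2
    rw [hv, ← hK] at hc2 hh2
    obtain ⟨δ, hδ0, hδ⟩ : ∃ δ, 0 < δ ∧ δ = 1 / (2 * p * (1 + (CG + CF) * K)) :=
      ⟨_, by positivity, rfl⟩
    rw [← hδ] at hcδ hhδ
    have hc3 := ENNReal.toReal_le_of_le_ofReal hδ0.le hcδ.le
    have hh3 := ENNReal.toReal_le_of_le_ofReal hδ0.le hhδ.le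
    have hc4 := hc1.trans (mul_le_mul_of_nonneg_left
      (hc2.trans (mul_le_mul_of_nonneg_right hc3 hK0)) hCG)
    have hh4 := hh1.trans (mul_le_mul_of_nonneg_left
      (hh2.trans (mul_le_mul_of_nonneg_right hh3 hK0)) hCF)
    have hsmall : CG * (δ * K) + CF * (δ * K) ≤ 1 / (2 * p) := by
      have h1 : 1 / (2 * p) = δ * (1 + (CG + CF) * K) := by
        rw [hδ]
        field_simp
      rw [h1]
      linarith
    have hhalf : 1 / p = 1 / (2 * p) + 1 / (2 * p) := by
      field_simp
      norm_num
    rw [PGradient.energy, PGradient.integral_norm_grad_rpow, hv, Real.one_rpow, mul_one]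
    linarith [le_abs_self (∫ x in Ω, c x * PGradient.G p q μ (PGradient.fn v x)),
      le_abs_self (∫ x in Ω, h x * PGradient.F p μ (PGradient.fn v x))]
  · obtain ⟨v, hv, hcv⟩ := PGradient.exists_nonneg_mul_ne_zero (p := p) hΩo hcne
    have hpos := PGradient.poincareNorm_pos hΩb hpN hcv
    -- Taking `t > 1/‖v‖` puts `t • v` outside the unit sphere.
    obtain ⟨t, ht, htn, ht0⟩ := (((hlim v hv hcv).eventually_le_atBot 0).and
      ((eventually_gt_atTop (1 / PGradient.poincareNorm v)).and (eventually_ge_atTop 0))).exists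
    refine ⟨t • v, ?_, ht⟩
    rw [PGradient.poincareNorm_smul, abs_of_nonneg ht0]
    exact (div_lt_iff₀ hpos).1 htn
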